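/- Let $k$ be a field. A linear category is an abelian category with a compatible enrichment over $k$-vector spaces. It is called finite if (1) its morphism spaces are finite-dimensional, (2) every object $X$ has finite length, meaning that every strictly decreasing chain of subobjects of $X$ is finite, (3) it has enough projectives, and (4) it has finitely many isomorphism classes of simple objects. A finite tensor category is a finite linear category $\mathcal C$ with a monoidal structure whose tensor product $\otimes\colon \mathcal C\times\mathcal C\to\mathcal C$ is $k$-linear in each variable and which is rigid, i.e. every object has both a left and a right dual. A (left) $\mathcal C$-module category is a linear category $\mathcal M$ together with a functor $\otimes^{\mathcal M}\colon\mathcal C\times\mathcal M\to\mathcal M$, $(c,m)\mapsto c\otimes m$, that is $k$-linear in each variable, and natural isomorphisms $(c\otimes c')\otimes m\cong c\otimes(c'\otimes m)$ and $1_{\mathcal C}\otimes m\cong m$ satisfying the pentagon and triangle identities; it is finite if $\mathcal M$ is finite as a linear category. Let $\mathcal C$ be a finite tensor category over $k$ and let $\mathcal M$ be a finite $\mathcal C$-module category. Suppose that the action is right exact in $\mathcal C$, i.e. for every $m\in\mathcal M$ the functor $(-)\otimes m\colon\mathcal C\to\mathcal M$ is right exact. Then the action is exact in each variable separately: for every $c\in\mathcal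 C$ the functor $c\otimes(-)\colon\mathcal M\to\mathcal M$ is exact, and for every $m\in\mathcal M$ the functor $(-)\otimes m\colon\mathcal C\to\mathcal M$ is exact. -/

import Mathlib

open CategoryTheory CategoryTheory.Limits CategoryTheory.MonoidalCategory

universe w v₁ v₂ u₁ u₂

/-- A linear category over `k` (an abelian category enriched over `k`-vector spaces) is *finite*
if its morphism spaces are finite-dimensional, all its objects have finite length, it has enough
projectives, and it has finitely many isomorphism classes of simple objects. -/
class IsFiniteLinearCategory (k : Type w) [Field k] (C : Type u₁) [Category.{v₁} C]
    [Abelian C] [Linear k C] : Prop where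
  /-- The morphism spaces are finite-dimensional. -/
  finiteDimensional_hom : ∀ X Y : C, FiniteDimensional k (X ⟶ Y)
  /-- Every object has finite length, in the sense that every strictly decreasing chain of
  subobjects is finite. (In the presence of the other three conditions this is equivalent to the
  existence of a finite composition series.) -/
  finiteLength : ∀ X : C, IsArtinianObject X
  /-- Every object is a quotient of a projective object. -/
  enoughProjectives : EnoughProjectives C
  /-- There is a finite list of objects such that every simple object is isomorphic to one of
  them. -/
  finite_simples : ∃ (n : ℕ) (S : Fin n → C),
    ∀ X : C, Simple X → ∃ i : Fin n, Nonempty (X ≅ S i)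

/-- The action bifunctor `C × M → M` of a left action of a monoidal category `C` on `M` is
`k`-bilinear: each functor `c ⊙ₗ - : M ⥤ M` and each functor `- ⊙ₗ m : C ⥤ M` is additive and
`k`-linear. For linear categories `C` and `M`, such an action is the structure of a left
`C`-module category on `M`. -/
class IsBilinearAction (k : Type w) [Field k]
    (C : Type u₁) [Category.{v₁} C] [Preadditive C] [Linear k C] [MonoidalCategory C]
    (M : Type u₂) [Category.{v₂} M] [Preadditive M] [Linear k M]
    [MonoidalLeftAction C M] : Prop where
  additive_right : ∀ c : C, ((MonoidalLeftAction.curriedAction C M).obj c).Additive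
  linear_right : ∀ c : C, ((MonoidalLeftAction.curriedAction C M).obj c).Linear k
  additive_left : ∀ m : M, ((MonoidalLeftAction.curriedAction C M).flip.obj m).Additive
  linear_left : ∀ m : M, ((MonoidalLeftAction.curriedAction C M).flip.obj m).Linear k

/-- A functor between abelian categories is *right exact* if it preserves finite colimits. -/
def IsRightExact {A : Type u₁} [Category.{v₁} A] {B : Type u₂} [Category.{v₂} B]
    (F : A ⥤ B) : Prop :=
  PreservesFiniteColimits F

/-- A functor between abelian categories is *exact* if it preserves finite limits and finite
colimits. -/
def IsExact {A : Type u₁} [Category.{v₁} A] {B : Type u₂} [Category.{v₂} B]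
    (F : A ⥤ B) : Prop :=
  PreservesFiniteLimits F ∧ PreservesFiniteColimits F

namespace CategoryTheory.MonoidalCategory.MonoidalLeftAction

open scoped MonoidalLeftAction

variable {C : Type u₁} [Category.{v₁} C] [MonoidalCategory C]
  {M : Type u₂} [Category.{v₂} M] [MonoidalLeftAction C M]

/-! Duals in `C` give `c ⊙ₗ -` adjoints on both sides, hence exactness. For `- ⊙ₗ m`, take a mono
`f` and let `i` be the kernel of `f ⊵ₗ m`. If `P` is projective, `P ◁ f` splits, so `P ⊴ₗ (f ⊵ₗ m)`
is mono and `P ⊴ₗ i = 0`. An epi `P ⟶ 𝟙_ C` still acts as an epi by right exactness, which forces `i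
= 0`. -/

lemma inv_associator_actionHomLeft (c₁ c₂ c₃ : C) (m : M) :
    (α_ c₁ c₂ c₃).inv ⊵ₗ m = (αₗ c₁ (c₂ ⊗ c₃) m).hom ≫ c₁ ⊴ₗ (αₗ c₂ c₃ m).hom ≫
      (αₗ c₁ c₂ (c₃ ⊙ₗ m)).inv ≫ (αₗ (c₁ ⊗ c₂) c₃ m).inv := by
  rw [← cancel_epi ((α_ c₁ c₂ c₃).hom ⊵ₗ m), ← comp_actionHomLeft, Iso.hom_inv_id,
    associator_actionHom_assoc]
  simp

lemma hom_associator_actionHomLeft (c₁ c₂ c₃ : C) (m : M) :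
    (α_ c₁ c₂ c₃).hom ⊵ₗ m = (αₗ (c₁ ⊗ c₂) c₃ m).hom ≫ (αₗ c₁ c₂ (c₃ ⊙ₗ m)).hom ≫
      c₁ ⊴ₗ (αₗ c₂ c₃ m).inv ≫ (αₗ c₁ (c₂ ⊗ c₃) m).inv := by
  rw [← associator_actionHom_assoc]
  simp

lemma inv_leftUnitor_actionHomLeft (c : C) (m : M) :
    (λ_ c).inv ⊵ₗ m = (λₗ (c ⊙ₗ m)).inv ≫ (αₗ _ _ _).inv := by
  rw [← cancel_epi ((λ_ c).hom ⊵ₗ m), ← comp_actionHomLeft, Iso.hom_inv_id]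
  simp

lemma inv_rightUnitor_actionHomLeft (c : C) (m : M) :
    (ρ_ c).inv ⊵ₗ m = c ⊴ₗ (λₗ m).inv ≫ (αₗ _ _ _).inv := by
  rw [← cancel_epi ((ρ_ c).hom ⊵ₗ m), ← comp_actionHomLeft, Iso.hom_inv_id]
  simp

variable (M) in
/-- An exact pairing of `X` and `Y` makes the action of `Y` left adjoint to the action of `X`. -/
def actionLeftAdjunction (X Y : C) [ExactPairing X Y] : actionLeft M Y ⊣ actionLeft M X where
  unit :=
    { app m := (λₗ m).inv ≫ (η_ X Y) ⊵ₗ m ≫ (αₗ X Y m).hom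
      naturality m m' f := by
        have h := action_exchange (η_ X Y) f
        simp only [unit_actionHomRight, tensor_actionHomRight, Category.assoc] at h
        change f ≫ (λₗ m').inv ≫ (η_ X Y) ⊵ₗ m' ≫ (αₗ X Y m').hom =
          ((λₗ m).inv ≫ (η_ X Y) ⊵ₗ m ≫ (αₗ X Y m).hom) ≫ X ⊴ₗ Y ⊴ₗ f
        rw [← cancel_epi (λₗ[C] m).hom, reassoc_of% h]
        simp }
  counit :=
    { app m := (αₗ Y X m).inv ≫ (ε_ X Y) ⊵ₗ m ≫ (λₗ m).hom
      naturality m m' f := by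
        have h := action_exchange (ε_ X Y) f
        simp only [unit_actionHomRight, tensor_actionHomRight, Category.assoc] at h
        change Y ⊴ₗ X ⊴ₗ f ≫ (αₗ Y X m').inv ≫ (ε_ X Y) ⊵ₗ m' ≫ (λₗ m').hom =
          ((αₗ Y X m).inv ≫ (ε_ X Y) ⊵ₗ m ≫ (λₗ m).hom) ≫ f
        rw [← cancel_epi (αₗ Y X m).hom, reassoc_of% h]
        simp }
  left_triangle_components m := by
    -- The zigzag identity of the duality acts on `m`; composing with unitors makes it an
    -- endomorphism of `Y ⊙ₗ m`.
    have h := congrArg (fun f => (ρ_ Y).inv ⊵ₗ m ≫ f ⊵ₗ m ≫ (λ_ Y).hom ⊵ₗ m)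
      (ExactPairing.coevaluation_evaluation (X := X) (Y := Y))
    simp only [comp_actionHomLeft, inv_associator_actionHomLeft, inv_rightUnitor_actionHomLeft,
      whiskerLeft_actionHomLeft, whiskerRight_actionHomLeft, leftUnitor_actionHom,
      inv_leftUnitor_actionHomLeft, rightUnitor_actionHom, Category.assoc,
      Iso.inv_hom_id_assoc, Iso.inv_hom_id] at h
    change Y ⊴ₗ ((λₗ m).inv ≫ (η_ X Y) ⊵ₗ m ≫ (αₗ X Y m).hom) ≫
      (αₗ Y X (Y ⊙ₗ m)).inv ≫ (ε_ X Y) ⊵ₗ (Y ⊙ₗ m) ≫ (λₗ (Y ⊙ₗ m)).hom = 𝟙 (Y ⊙ₗ m)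
    simpa [-actionHomLeft_action] using h
  right_triangle_components m := by
    have h := congrArg (fun f => (λ_ X).inv ⊵ₗ m ≫ f ⊵ₗ m ≫ (ρ_ X).hom ⊵ₗ m)
      (ExactPairing.evaluation_coevaluation (X := X) (Y := Y))
    simp only [comp_actionHomLeft, hom_associator_actionHomLeft, inv_rightUnitor_actionHomLeft,
      whiskerLeft_actionHomLeft, whiskerRight_actionHomLeft, leftUnitor_actionHom,
      inv_leftUnitor_actionHomLeft, rightUnitor_actionHom, Category.assoc,
      Iso.inv_hom_id_assoc] at h
    change ((λₗ (X ⊙ₗ m)).inv ≫ (η_ X Y) ⊵ₗ (X ⊙ₗ m) ≫ (αₗ X Y (X ⊙ₗ m)).hom) ≫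
      X ⊴ₗ ((αₗ Y X m).inv ≫ (ε_ X Y) ⊵ₗ m ≫ (λₗ m).hom) = 𝟙 (X ⊙ₗ m)
    simpa [-actionHomLeft_action] using h

variable (M) in
lemma isExact_actionLeft [RigidCategory C] (c : C) : IsExact (actionLeft M c) :=
  ⟨have := (actionLeftAdjunction M c cᘁ).isRightAdjoint; inferInstance,
    have := (actionLeftAdjunction M (ᘁc) c).isLeftAdjoint; inferInstance⟩

end CategoryTheory.MonoidalCategory.MonoidalLeftAction

section

variable {C : Type u₁} [Category.{v₁} C] [MonoidalCategory C]

/-- The right adjoint `- ⊗ Y` of `- ⊗ X` is itself a left adjoint, so it preserves epis; hence `- ⊗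
X` preserves projectives. -/
lemma CategoryTheory.Projective.tensor_left [RigidCategory C] (P X : C) [Projective P] :
    Projective (P ⊗ X) := by
  let Y : C := HasRightDual.rightDual X
  have := (tensorRightAdjunction Y (HasRightDual.rightDual Y)).isLeftAdjoint
  exact (tensorRightAdjunction X Y).map_projective P inferInstance

variable [Abelian C] [MonoidalPreadditive C] [RigidCategory C]

/-- Tensoring with a projective object splits every monomorphism. -/
lemma CategoryTheory.Projective.isSplitMono_whiskerLeft (P : C) [Projective P]
    {A B : C} (f : A ⟶ B) [Mono f] : IsSplitMono (P ◁ f) := by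
  have := (tensorLeftAdjunction P Pᘁ).isRightAdjoint
  have := (tensorLeftAdjunction (ᘁP) P).isLeftAdjoint
  let S := ShortComplex.mk f (cokernel.π f) (cokernel.condition f)
  have hS : S.ShortExact :=
    { exact := ShortComplex.exact_cokernel f
      mono_f := inferInstanceAs (Mono f)
      epi_g := inferInstanceAs (Epi (cokernel.π f)) }
  have hS' := hS.map_of_exact (tensorLeft P)
  have : Projective (S.map (tensorLeft P)).X₃ := Projective.tensor_left P (cokernel f)
  let s := hS'.splittingOfProjective
  exact ⟨⟨⟨s.r, s.f_r⟩⟩⟩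

open MonoidalLeftAction
open scoped MonoidalLeftAction

/-- If an action of a rigid abelian category with enough projectives preserves epimorphisms in the
acting variable, then it preserves monomorphisms in that variable. -/
lemma CategoryTheory.MonoidalCategory.MonoidalLeftAction.preservesMonomorphisms_actionRight
    [EnoughProjectives C] {M : Type u₂} [Category.{v₂} M] [Abelian M] [MonoidalLeftAction C M]
    (h : ∀ m : M, (actionRight C m).PreservesEpimorphisms) (m : M) :
    (actionRight C m).PreservesMonomorphisms where
  preserves {A B} f hf := by
    let P := Projective.over (𝟙_ C)
    let p : P ⟶ 𝟙_ C := Projective.π (𝟙_ C)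
    have := Projective.isSplitMono_whiskerLeft P f
    have hPf : Mono (P ⊴ₗ (f ⊵ₗ m)) := by
      -- Every functor preserves split monos.
      have : Mono ((P ◁ f) ⊵ₗ m) := inferInstanceAs (Mono ((actionRight C m).map (P ◁ f)))
      have e : P ⊴ₗ (f ⊵ₗ m) = (αₗ P A m).inv ≫ (P ◁ f) ⊵ₗ m ≫ (αₗ P B m).hom := by simp
      rw [e]
      infer_instance
    have : (actionLeft M P).PreservesZeroMorphisms :=
      have := (actionLeftAdjunction M (ᘁP) P).isLeftAdjoint
      inferInstance
    change Mono (f ⊵ₗ m)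
    refine Preadditive.mono_of_kernel_zero ?_
    set i := kernel.ι (f ⊵ₗ m)
    have hi : P ⊴ₗ i = 0 := by
      rw [← cancel_mono (P ⊴ₗ (f ⊵ₗ m)), ← actionHomRight_comp, kernel.condition, zero_comp]
      exact (actionLeft M P).map_zero _ _
    -- Here `h` is needed at the kernel rather than at `m`.
    have : Epi (p ⊵ₗ kernel (f ⊵ₗ m)) :=
      have := h (kernel (f ⊵ₗ m))
      inferInstanceAs (Epi ((actionRight C (kernel (f ⊵ₗ m))).map p))
    have e : (𝟙_ C) ⊴ₗ i = 0 := by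
      rw [← cancel_epi (p ⊵ₗ kernel (f ⊵ₗ m)), ← action_exchange, hi, zero_comp, comp_zero]
    rw [← cancel_epi (λₗ[C] (kernel (f ⊵ₗ m))).hom, actionUnitIso_hom_naturality, e, zero_comp,
      comp_zero]

end

theorem corollary2p18 (k : Type w) [Field k]
    -- `C` is a finite tensor category over `k`
    (C : Type u₁) [Category.{v₁} C] [Abelian C] [Linear k C]
    [MonoidalCategory C] [MonoidalPreadditive C] [MonoidalLinear k C] [RigidCategory C]
    [IsFiniteLinearCategory k C]
    -- `M` is a finite left `C`-module category
    (M : Type u₂) [Category.{v₂} M] [Abelian M] [Linear k M]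
    [MonoidalLeftAction C M] [IsBilinearAction k C M]
    [IsFiniteLinearCategory k M]
    -- the action is right exact in `C`
    (hright : ∀ m : M, IsRightExact ((MonoidalLeftAction.curriedAction C M).flip.obj m)) :
    (∀ c : C, IsExact ((MonoidalLeftAction.curriedAction C M).obj c)) ∧
      (∀ m : M, IsExact ((MonoidalLeftAction.curriedAction C M).flip.obj m)) := by
  refine ⟨MonoidalLeftAction.isExact_actionLeft M, fun m => ⟨?_, hright m⟩⟩
  have := IsFiniteLinearCategory.enoughProjectives k (C := C)
  have := IsBilinearAction.additive_left k (C := C) m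
  have (m : M) : PreservesFiniteColimits (MonoidalLeftAction.actionRight C m) := hright m
  have := MonoidalLeftAction.preservesMonomorphisms_actionRight (C := C) (M := M)
    (fun m => inferInstance) m
  -- For an additive functor, preserving monos and cokernels suffices for exactness.
  have := Functor.preservesHomology_of_preservesMonos_and_cokernels
    (MonoidalLeftAction.actionRight C m)
  exact Functor.preservesFiniteLimits_of_preservesHomology (MonoidalLeftAction.actionRight C m)
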